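/- Let $X$ be a set. A \emph{reproducing kernel} on $X$ is a symmetric function $K:X\times X\to\mathbb R$ with $\sum_{i,j=1}^m\alpha_i\alpha_jK(x_i,x_j)\ge 0$ for all $m\ge1$, $\alpha_i\in\mathbb R$, $x_i\in X$. Write $\mathcal H(K)$ for its reproducing kernel Hilbert space, $k_x=K(x,\cdot)\in\mathcal H(K)$ for its generators and, for $U\subseteq X$, $K_U=K|_{U\times U}$ and $k_{x,U}=k_x|_U\in\mathcal H(K_U)$. Let $\Pi_U$ be the orthogonal projection of $\mathcal H(K)$ onto the closed linear span of $\{k_u:u\in U\}$. Let $n\ge 1$, let $X_1,\dots,X_n\subseteq X$ satisfy $X=\bigcup_{j=1}^nX_j$ and $X_i\cap X_k\subseteq X_i\cap X_j$ for $1\le i<j<k\le n$, and let $\Omega=\bigcup_{j=1}^n(X_j\times X_j)$ (an \emph{$n$-serrated domain}). Let $K_\Omega:\Omega\to\mathbb R$ be a \emph{partially reproducing kernel}: $K_\Omega|_{A\times A}$ is a reproducing kernel on $A$ for every $A\subseteq X$ with $A\times A\subseteq\Omega$. A \emph{completion} of $K_\Omega$ is a reproducing kernel $K$ on $X$ with $K|_\Omega=K_\Omega$.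 A set $S\subseteq X$ \emph{separates} $x,y\in X\setminus S$ if for every finite sequence $x=z_0,z_1,\dots,z_{m+1}=y$ in $X$ ($m\ge0$) with $(z_k,z_{k+1})\in\Omega$ for $0\le k\le m$ some $z_k$ with $1\le k\le m$ lies in $S$. A completion $K$ is \emph{canonical} if $K(x,y)=\langle k_{x,S},k_{y,S}\rangle_{\mathcal H(K_S)}$ whenever $S$ separates $x$ and $y$. \textbf{Theorem (Projections).} The partially reproducing kernel $K_\Omega$ has exactly one canonical completion $K_\star$, and for every completion $K$ of $K_\Omega$ the following are equivalent: (1) $K=K_\star$; (2) $\mathbf I=\sum_{j=1}^{n}\Pi_{X_j}-\sum_{j=1}^{n-1}\Pi_{X_j\cap X_{j+1}}$ on $\mathcal H(K)$; (3) for every $1\le j<n$, with $A_j=\bigcup_{k=1}^{j}X_k$ and $B_j=\bigcup_{k=j+1}^{n}X_k$, one has $\Pi_{X_j\cap X_{j+1}}=\Pi_{A_j}\Pi_{B_j}=\Pi_{B_j}\Pi_{A_j}$. \textbf{The $2$-serrated case.} Let $X=X_1\cup X_2$, let $\Omega=(X_1\times X_1)\cup(X_2\times X_2)$ and let $K_\Omega$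 be a partially reproducing kernel on $\Omega$. Then there is a reproducing kernel $K_\star$ on $X$ which is the only canonical completion of $K_\Omega$ and also the only completion $K$ of $K_\Omega$ with $K(x,y)=\langle k_{x,X_1\cap X_2},k_{y,X_1\cap X_2}\rangle_{\mathcal H(K_{X_1\cap X_2})}$ for all $x\in X_1$, $y\in X_2$. For every completion $K$ of $K_\Omega$ the following are equivalent: (1) $K=K_\star$; (2) $\mathbf I-\Pi_{X_1}-\Pi_{X_2}+\Pi_{X_1\cap X_2}=\mathbf 0$; (3) $\Pi_{X_1\cap X_2}=\Pi_{X_1}\Pi_{X_2}=\Pi_{X_2}\Pi_{X_1}$. -/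

import Mathlib

open scoped InnerProductSpace

noncomputable section

namespace KernelCompletion

/-- A symmetric real function of two variables all of whose finite quadratic forms are
nonnegative. -/
def IsReproducingKernel {X : Type*} (K : X → X → ℝ) : Prop :=
  (∀ x y, K x y = K y x) ∧
    ∀ (n : ℕ) (α : Fin n → ℝ) (x : Fin n → X),
      0 ≤ ∑ i, ∑ j, α i * α j * K (x i) (x j)

/-- A (real, scalar-valued) reproducing kernel on the set `X`. -/
@[ext]
structure ReproducingKernel (X : Type*) where
  toFun : X → X → ℝ
  isReproducingKernel : IsReproducingKernel toFun

namespace ReproducingKernel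

variable {X : Type*}

instance : CoeFun (ReproducingKernel X) (fun _ => X → X → ℝ) := ⟨ReproducingKernel.toFun⟩

/-- The kernel `K` in Mathlib's format for operator-valued kernels: the scalar `K x y` is regarded
as the operator "multiplication by `K x y`" on `ℝ`. -/
def opKernel (K : ReproducingKernel X) : Matrix X X (ℝ →L[ℝ] ℝ) :=
  Matrix.of fun x y => K x y • ContinuousLinearMap.id ℝ ℝ

theorem posSemidef_opKernel (K : ReproducingKernel X) : K.opKernel.PosSemidef := by
  obtain ⟨hs, hp⟩ := K.isReproducingKernel
  have key := (RKHS.posSemidef_tfae (K := K.opKernel)).out 0 2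
  refine key.mpr ⟨?_, fun f => ?_⟩
  · have h1 : star (ContinuousLinearMap.id ℝ ℝ) = ContinuousLinearMap.id ℝ ℝ :=
      star_one (ℝ →L[ℝ] ℝ)
    ext x y
    simp [opKernel, Matrix.conjTranspose_apply, h1, hs x y]
  · let e := f.support.equivFin.symm
    have h := hp _ (fun i => f (e i)) (fun i => (e i : X))
    have h1 : (∑ i, ∑ j, f (e i) * f (e j) * K (e i) (e j)) =
        ∑ a : f.support, ∑ b : f.support, f a * f b * K a b := by
      rw [← e.sum_comp]
      refine Finset.sum_congr rfl fun i _ => ?_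
      rw [← e.sum_comp]
    rw [h1] at h
    have h2 : (∑ a : f.support, ∑ b : f.support, f a * f b * K a b) =
        ∑ a ∈ f.support, ∑ b ∈ f.support, f a * f b * K a b := by
      rw [Finset.sum_coe_sort f.support
        (fun a => ∑ b : f.support, f a * f b * K a b)]
      refine Finset.sum_congr rfl fun i _ => ?_
      rw [Finset.sum_coe_sort f.support (fun b => f i * f b * K i b)]
    rw [h2] at h
    refine h.trans_eq ?_
    simp only [Finsupp.sum, opKernel, Matrix.of_apply]
    simp only [FunLike.coe_smul, Pi.smul_apply, ContinuousLinearMap.id_apply,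
      smul_eq_mul, map_sum, RCLike.inner_apply, conj_trivial, RCLike.re_to_real]
    refine Finset.sum_congr rfl fun a _ => Finset.sum_congr rfl fun b _ => ?_
    rw [hs a b]
    ring

instance (K : ReproducingKernel X) : Fact K.opKernel.PosSemidef := ⟨K.posSemidef_opKernel⟩

/-- The reproducing kernel Hilbert space of `K`; its elements coerce to functions `X → ℝ`. -/
abbrev H (K : ReproducingKernel X) : Type _ := RKHS.OfKernel K.opKernel

/-- The generator `k_x` of `K`, as an element of the reproducing kernel Hilbert space. -/
def generator (K : ReproducingKernel X) (x : X) : K.H := RKHS.kerFun K.H x (1 : ℝ)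

theorem generator_apply (K : ReproducingKernel X) (x y : X) : K.generator x y = K x y := by
  rw [generator, RKHS.kerFun_apply, RKHS.OfKernel.kernel_ofKernel]
  simp [opKernel, K.isReproducingKernel.1 x y]

theorem inner_generator (K : ReproducingKernel X) (x y : X) :
    ⟪K.generator x, K.generator y⟫_ℝ = K x y := by
  rw [generator, RKHS.kerFun_inner]
  simp [generator_apply, K.isReproducingKernel.1 x y]

/-- The orthogonal projection `Π_U` of the Hilbert space of `K` onto the closed linear span of the
generators `k_u`, `u ∈ U`. -/
def proj (K : ReproducingKernel X) (U : Set X) : K.H →L[ℝ] K.H :=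
  (Submodule.span ℝ (K.generator '' U)).topologicalClosure.starProjection

/-- The subkernel `K_A`, the restriction of `K` to `A × A`. -/
def restrict (K : ReproducingKernel X) (A : Set X) : ReproducingKernel A where
  toFun a b := K a b
  isReproducingKernel :=
    ⟨fun a b => K.isReproducingKernel.1 a b,
      fun n α x => K.isReproducingKernel.2 n α fun i => x i⟩

/-- `K x y = ⟨k_{x,S}, k_{y,S}⟩`, the inner product being that of the Hilbert space of the
subkernel `K_S`, and `k_{u,S}` being the element of that space which is the function
`v ↦ K u v` on `S` (it is unique, since elements are determined by their values). -/
def EqInnerOn (K : ReproducingKernel X) (S : Set X) (x y : X) : Prop :=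
  ∃ f g : (K.restrict S).H, (∀ v : S, f v = K x v) ∧ (∀ v : S, g v = K y v) ∧
    K x y = ⟪f, g⟫_ℝ

end ReproducingKernel

variable {X : Type*}

/-- `KΩ : Ω → ℝ` is a partially reproducing kernel: its restriction to `A × A` is a reproducing
kernel whenever `A × A ⊆ Ω`. -/
def IsPartiallyReproducing {Ω : Set (X × X)} (KΩ : Ω → ℝ) : Prop :=
  ∀ (A : Set X) (hA : A ×ˢ A ⊆ Ω),
    IsReproducingKernel fun a b : A => KΩ ⟨((a : X), (b : X)), hA ⟨a.2, b.2⟩⟩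

/-- The reproducing kernel `K` on `X` is a completion of `KΩ`. -/
def IsCompletion {Ω : Set (X × X)} (KΩ : Ω → ℝ) (K : ReproducingKernel X) : Prop :=
  ∀ p : Ω, K p.1.1 p.1.2 = KΩ p

/-- `S` separates `x, y ∉ S` in the graph `Ω`: every path `x = z 0, z 1, …, z (m + 1) = y` has an
interior vertex in `S`. -/
def Separates (Ω : Set (X × X)) (S : Set X) (x y : X) : Prop :=
  x ∉ S ∧ y ∉ S ∧
    ∀ (m : ℕ) (z : ℕ → X), z 0 = x → z (m + 1) = y →
      (∀ k ≤ m, (z k, z (k + 1)) ∈ Ω) → ∃ k, 1 ≤ k ∧ k ≤ m ∧ z k ∈ S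

/-- `K` is a canonical completion of `KΩ`. -/
def IsCanonicalCompletion {Ω : Set (X × X)} (KΩ : Ω → ℝ) (K : ReproducingKernel X) : Prop :=
  IsCompletion KΩ K ∧ ∀ (S : Set X) (x y : X), Separates Ω S x y → K.EqInnerOn S x y

/-- `Ω` is an `n`-serrated domain on `X` with pieces `V 1, …, V n` (the values of `V` at other
indices are irrelevant). Symmetry of `Ω` and the inclusion of the diagonal follow from the
fields. -/
structure IsSerrated (n : ℕ) (V : ℕ → Set X) (Ω : Set (X × X)) : Prop where
  one_le : 1 ≤ n
  cover : ⋃ j ∈ Finset.Icc 1 n, V j = Set.univ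
  inter_subset : ∀ i j k, 1 ≤ i → i < j → j < k → k ≤ n → V i ∩ V k ⊆ V i ∩ V j
  eq_iUnion : Ω = ⋃ j ∈ Finset.Icc 1 n, V j ×ˢ V j

end KernelCompletion

end

noncomputable section

namespace KernelCompletion

/-- The Gram function of a family of vectors is a reproducing kernel. -/
theorem isReproducingKernel_gram {X E : Type*} [NormedAddCommGroup E] [InnerProductSpace ℝ E]
    (φ : X → E) : IsReproducingKernel fun x y => ⟪φ x, φ y⟫_ℝ := by
  refine ⟨fun x y => real_inner_comm _ _, fun n α x => ?_⟩
  have h : ∑ i, ∑ j, α i * α j * ⟪φ (x i), φ (x j)⟫_ℝ =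
      ⟪∑ i, α i • φ (x i), ∑ j, α j • φ (x j)⟫_ℝ := by
    simp only [sum_inner]
    refine Finset.sum_congr rfl fun i _ => ?_
    simp only [inner_sum, real_inner_smul_left, real_inner_smul_right]
    exact Finset.sum_congr rfl fun j _ => by ring
  rw [h]
  exact real_inner_self_nonneg

theorem IsReproducingKernel.add {X : Type*} {K L : X → X → ℝ} (hK : IsReproducingKernel K)
    (hL : IsReproducingKernel L) : IsReproducingKernel fun x y => K x y + L x y := by
  refine ⟨fun x y => congrArg₂ _ (hK.1 x y) (hL.1 x y), fun n α x => ?_⟩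
  simp only [mul_add, Finset.sum_add_distrib]
  exact add_nonneg (hK.2 n α x) (hL.2 n α x)

namespace ReproducingKernel

variable {X : Type*} (K : ReproducingKernel X)

theorem inner_generator_left (x : X) (f : K.H) : ⟪K.generator x, f⟫_ℝ = f x := by
  rw [generator, RKHS.kerFun_inner]
  simp

/-- The closed linear span of the generators `k_u`, `u ∈ U`. -/
def closedSpan (U : Set X) : Submodule ℝ K.H :=
  (Submodule.span ℝ (K.generator '' U)).topologicalClosure

instance (U : Set X) : CompleteSpace (K.closedSpan U) :=
  (Submodule.isClosed_topologicalClosure _).completeSpace_coe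

variable {K}

theorem generator_mem_closedSpan {U : Set X} {x : X} (hx : x ∈ U) :
    K.generator x ∈ K.closedSpan U :=
  Submodule.le_topologicalClosure _ (Submodule.subset_span ⟨x, hx, rfl⟩)

theorem closedSpan_mono {U V : Set X} (h : U ⊆ V) : K.closedSpan U ≤ K.closedSpan V :=
  Submodule.topologicalClosure_mono (Submodule.span_mono (Set.image_mono h))

/-- Continuous linear maps which agree on the generators agree on their closed span. -/
theorem eqOn_closedSpan {E : Type*} [NormedAddCommGroup E] [NormedSpace ℝ E]
    {U : Set X} {S T : K.H →L[ℝ] E}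
    (h : ∀ u ∈ U, S (K.generator u) = T (K.generator u)) {w : K.H} (hw : w ∈ K.closedSpan U) :
    S w = T w := by
  have h1 : K.closedSpan U ≤ LinearMap.eqLocus S.toLinearMap T.toLinearMap := by
    refine Submodule.topologicalClosure_minimal _ (Submodule.span_le.2 ?_)
      (isClosed_eq S.continuous T.continuous)
    rintro _ ⟨u, hu, rfl⟩
    exact h u hu
  exact h1 hw

theorem inner_eq_zero_of_mem_closedSpan {U : Set X} {v w : K.H}
    (h : ∀ u ∈ U, ⟪v, K.generator u⟫_ℝ = 0) (hw : w ∈ K.closedSpan U) : ⟪v, w⟫_ℝ = 0 :=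
  eqOn_closedSpan (S := innerSL ℝ v) (T := 0) (by simpa using h) hw

theorem closedSpan_univ : K.closedSpan Set.univ = ⊤ := by
  rw [closedSpan, Submodule.topologicalClosure_eq_top_iff, Submodule.eq_bot_iff]
  intro f hf
  refine RKHS.ext fun x => ?_
  rw [← inner_generator_left, RKHS.coe_zero, Pi.zero_apply]
  exact hf _ (Submodule.subset_span ⟨x, trivial, rfl⟩)

theorem ext_generator {E : Type*} [NormedAddCommGroup E] [NormedSpace ℝ E] {S T : K.H →L[ℝ] E}
    (h : ∀ u, S (K.generator u) = T (K.generator u)) : S = T :=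
  ContinuousLinearMap.ext fun w =>
    eqOn_closedSpan (U := Set.univ) (fun u _ => h u) (by rw [closedSpan_univ]; trivial)

theorem proj_mem (U : Set X) (v : K.H) : K.proj U v ∈ K.closedSpan U :=
  Submodule.starProjection_apply_mem _ _

theorem proj_eq_self {U : Set X} {v : K.H} (hv : v ∈ K.closedSpan U) : K.proj U v = v :=
  Submodule.starProjection_eq_self_iff.2 hv

theorem inner_proj (U : Set X) (v w : K.H) : ⟪K.proj U v, w⟫_ℝ = ⟪v, K.proj U w⟫_ℝ :=
  Submodule.inner_starProjection_left_eq_right _ _ _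

theorem inner_sub_proj {U : Set X} (v : K.H) {w : K.H} (hw : w ∈ K.closedSpan U) :
    ⟪v - K.proj U v, w⟫_ℝ = 0 :=
  Submodule.starProjection_inner_eq_zero _ _ hw

theorem proj_eq_of {U : Set X} {v w : K.H} (hw : w ∈ K.closedSpan U)
    (h : ∀ u ∈ U, ⟪v - w, K.generator u⟫_ℝ = 0) : K.proj U v = w :=
  Submodule.eq_starProjection_of_mem_of_inner_eq_zero hw fun _ hz =>
    inner_eq_zero_of_mem_closedSpan h hz

theorem proj_eq_zero {U : Set X} {v : K.H} (h : ∀ u ∈ U, ⟪v, K.generator u⟫_ℝ = 0) :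
    K.proj U v = 0 :=
  proj_eq_of (Submodule.zero_mem _) (by simpa using h)

theorem proj_proj_of_subset {U V : Set X} (h : U ⊆ V) (v : K.H) :
    K.proj U (K.proj V v) = K.proj U v := by
  refine proj_eq_of (proj_mem _ _) fun u hu => ?_
  have hm := generator_mem_closedSpan (K := K) hu
  have h1 := inner_sub_proj v hm
  have h2 := inner_sub_proj v (closedSpan_mono h hm)
  rw [inner_sub_left] at h1 h2 ⊢
  linarith

theorem proj_proj_of_superset {U V : Set X} (h : U ⊆ V) (v : K.H) :
    K.proj V (K.proj U v) = K.proj U v :=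
  proj_eq_self (closedSpan_mono h (proj_mem _ _))

theorem proj_empty : K.proj ∅ = 0 :=
  ContinuousLinearMap.ext fun _ => proj_eq_zero (by simp)

/-- A family of vectors with Gram function `K` induces an isometry on the Hilbert space of `K`. -/
theorem exists_isometry {E : Type*} [NormedAddCommGroup E] [InnerProductSpace ℝ E]
    [CompleteSpace E] (φ : X → E) (h : ∀ x y, ⟪φ x, φ y⟫_ℝ = K x y) :
    ∃ J : K.H →L[ℝ] E, (∀ v w, ⟪J v, J w⟫_ℝ = ⟪v, w⟫_ℝ) ∧ ∀ x, J (K.generator x) = φ x := by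
  let e : (X →₀ ℝ) →ₗ[ℝ] K.H := Finsupp.linearCombination ℝ K.generator
  let f : (X →₀ ℝ) →ₗ[ℝ] E := Finsupp.linearCombination ℝ φ
  have hd : DenseRange e := by
    have h1 : (LinearMap.range e).topologicalClosure = ⊤ := by
      rw [Finsupp.range_linearCombination, ← Set.image_univ]
      exact closedSpan_univ
    exact (Submodule.dense_iff_topologicalClosure_eq_top.2 h1 :)
  have hn : ∀ x, ‖f x‖ ≤ 1 * ‖e x‖ := by
    intro x
    have : ⟪f x, f x⟫_ℝ = ⟪e x, e x⟫_ℝ := by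
      simp only [e, f, Finsupp.linearCombination_apply, Finsupp.sum, sum_inner, inner_sum,
        real_inner_smul_left, real_inner_smul_right, h, inner_generator]
    rw [one_mul, norm_eq_sqrt_real_inner, this, ← norm_eq_sqrt_real_inner]
  let J := f.extendOfNorm e
  have hJ : ∀ x, J (K.generator x) = φ x := by
    intro x
    have := LinearMap.extendOfNorm_eq (f := f) hd ⟨1, hn⟩ (Finsupp.single x 1)
    simpa [e, f, J] using this
  refine ⟨J, fun v w => ?_, hJ⟩
  have key : J.adjoint ∘L J = ContinuousLinearMap.id ℝ K.H := by
    refine ext_generator fun u => ?_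
    refine RKHS.ext fun x => ?_
    rw [← inner_generator_left, ← inner_generator_left, ContinuousLinearMap.comp_apply,
      ContinuousLinearMap.adjoint_inner_right, hJ, hJ, h, ContinuousLinearMap.id_apply,
      inner_generator]
  rw [← ContinuousLinearMap.adjoint_inner_right, ← ContinuousLinearMap.comp_apply, key,
    ContinuousLinearMap.id_apply]

/-- `A` and `B` are conditionally orthogonal given `S` in the Hilbert space of `K`. -/
def SplitsAlong (K : ReproducingKernel X) (S A B : Set X) : Prop :=
  ∀ x ∈ A, ∀ y ∈ B, ⟪K.generator x - K.proj S (K.generator x), K.generator y⟫_ℝ = 0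

theorem eqInnerOn_iff {S : Set X} {x y : X} :
    K.EqInnerOn S x y ↔
      ⟪K.generator x - K.proj S (K.generator x), K.generator y⟫_ℝ = 0 := by
  obtain ⟨J, hJ, hJg⟩ := exists_isometry (K := K.restrict S) (fun s : S => K.generator s)
    (fun s t => K.inner_generator s t)
  have hmem : ∀ f, J f ∈ K.closedSpan S := by
    intro f
    have h1 : (K.closedSpan S).starProjection ∘L J = J :=
      ext_generator fun u => by
        rw [ContinuousLinearMap.comp_apply, hJg]
        exact proj_eq_self (generator_mem_closedSpan u.2)
    rw [← h1]
    exact proj_mem _ _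
  have hproj : ∀ (f : (K.restrict S).H) (z : X), (∀ v : S, f v = K z v) →
      K.proj S (K.generator z) = J f := by
    intro f z hf
    refine proj_eq_of (hmem f) fun u hu => ?_
    have h1 := hJ f ((K.restrict S).generator ⟨u, hu⟩)
    rw [hJg, real_inner_comm ((K.restrict S).generator _), inner_generator_left, hf] at h1
    rw [inner_sub_left, h1, inner_generator, sub_self]
  have hex : ∀ z : X, ∃ f : (K.restrict S).H, ∀ v : S, f v = K z v := by
    refine fun z => ⟨J.adjoint (K.generator z), fun v => ?_⟩
    rw [← inner_generator_left, ContinuousLinearMap.adjoint_inner_right, hJg, inner_generator,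
      K.isReproducingKernel.1]
  have hinner : ∀ f g : (K.restrict S).H, (∀ v : S, f v = K x v) → (∀ v : S, g v = K y v) →
      ⟪f, g⟫_ℝ = ⟪K.proj S (K.generator x), K.generator y⟫_ℝ := by
    intro f g hf hg
    rw [← hJ, ← hproj f x hf, ← hproj g y hg, ← inner_proj,
      proj_eq_self (proj_mem _ _)]
  rw [inner_sub_left, inner_generator, sub_eq_zero]
  constructor
  · rintro ⟨f, g, hf, hg, h⟩
    rw [h, hinner f g hf hg]
  · intro h
    obtain ⟨f, hf⟩ := hex x
    obtain ⟨g, hg⟩ := hex y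
    exact ⟨f, g, hf, hg, by rw [h, hinner f g hf hg]⟩

theorem splitsAlong_iff {S A B : Set X} :
    K.SplitsAlong S A B ↔ ∀ x ∈ A, ∀ y ∈ B, K.EqInnerOn S x y := by
  simp only [SplitsAlong, eqInnerOn_iff]

theorem EqInnerOn.symm {S : Set X} {x y : X} (h : K.EqInnerOn S x y) : K.EqInnerOn S y x := by
  obtain ⟨f, g, hf, hg, h⟩ := h
  exact ⟨g, f, hg, hf, by rw [real_inner_comm, ← h, K.isReproducingKernel.1]⟩

theorem SplitsAlong.symm {S A B : Set X} (h : K.SplitsAlong S A B) : K.SplitsAlong S B A :=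
  splitsAlong_iff.2 fun y hy x hx => (splitsAlong_iff.1 h x hx y hy).symm

theorem eqInnerOn_of_mem_left {S : Set X} {x y : X} (hx : x ∈ S) : K.EqInnerOn S x y := by
  rw [eqInnerOn_iff, proj_eq_self (generator_mem_closedSpan hx), sub_self, inner_zero_left]

theorem eqInnerOn_of_mem_right {S : Set X} {x y : X} (hy : y ∈ S) : K.EqInnerOn S x y :=
  (eqInnerOn_of_mem_left hy).symm

theorem restrict_eq_restrict {L : ReproducingKernel X} {S : Set X}
    (h : ∀ s ∈ S, ∀ t ∈ S, K s t = L s t) : K.restrict S = L.restrict S :=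
  ReproducingKernel.ext (funext fun s => funext fun t => h s s.2 t t.2)

theorem eqInnerOn_iff_of_restrict_eq {S : Set X} {L : ReproducingKernel S}
    (h : K.restrict S = L) {x y : X} :
    K.EqInnerOn S x y ↔
      ∃ f g : L.H, (∀ v : S, f v = K x v) ∧ (∀ v : S, g v = K y v) ∧ K x y = ⟪f, g⟫_ℝ := by
  subst h
  rfl

/-- Two kernels which satisfy the same conditional orthogonality at `x`, `y` and agree on the data
that enter it agree at `x`, `y`. -/
theorem EqInnerOn.apply_eq {L : ReproducingKernel X} {S : Set X} {x y : X}
    (hK : K.EqInnerOn S x y) (hL : L.EqInnerOn S x y)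
    (h : ∀ s ∈ S, ∀ t ∈ S, K s t = L s t) (hx : ∀ s ∈ S, K x s = L x s)
    (hy : ∀ s ∈ S, K y s = L y s) : K x y = L x y := by
  rw [eqInnerOn_iff_of_restrict_eq (restrict_eq_restrict h)] at hK
  obtain ⟨f, g, hf, hg, h1⟩ := hK
  obtain ⟨f', g', hf', hg', h2⟩ := hL
  have e1 : f = f' := RKHS.ext fun v => by rw [hf, hf', hx v v.2]
  have e2 : g = g' := RKHS.ext fun v => by rw [hg, hg', hy v v.2]
  rw [h1, h2, e1, e2]

theorem EqInnerOn.congr {L : ReproducingKernel X} {S : Set X} {x y : X}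
    (hK : K.EqInnerOn S x y) (h : ∀ s ∈ S, ∀ t ∈ S, K s t = L s t)
    (hx : ∀ s ∈ S, K x s = L x s) (hy : ∀ s ∈ S, K y s = L y s) (hxy : K x y = L x y) :
    L.EqInnerOn S x y := by
  rw [eqInnerOn_iff_of_restrict_eq (restrict_eq_restrict h)] at hK
  obtain ⟨f, g, hf, hg, h1⟩ := hK
  exact ⟨f, g, fun v => by rw [hf, hx v v.2], fun v => by rw [hg, hy v v.2], by rw [← hxy, h1]⟩

theorem SplitsAlong.inner_eq_zero {S A B : Set X} (h : K.SplitsAlong S A B) {w : K.H}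
    (hw : w ∈ K.closedSpan A) (hS : ∀ s ∈ S, ⟪w, K.generator s⟫_ℝ = 0) {y : X} (hy : y ∈ B) :
    ⟪w, K.generator y⟫_ℝ = 0 := by
  have h1 : ⟪K.generator y - K.proj S (K.generator y), w⟫_ℝ = 0 :=
    inner_eq_zero_of_mem_closedSpan (h.symm y hy) hw
  have h2 := inner_eq_zero_of_mem_closedSpan hS (proj_mem S (K.generator y))
  rw [inner_sub_left, real_inner_comm, sub_eq_zero] at h1
  rw [h1, real_inner_comm, h2]

theorem SplitsAlong.proj_eq_proj {S A B : Set X} (h : K.SplitsAlong S A B) (hS : S ⊆ B) {w : K.H}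
    (hw : w ∈ K.closedSpan A) : K.proj B w = K.proj S w :=
  eqOn_closedSpan (fun _ hx => proj_eq_of (closedSpan_mono hS (proj_mem _ _)) (h _ hx)) hw

theorem SplitsAlong.proj_comp_proj {S A B : Set X} (h : K.SplitsAlong S A B) (hA : S ⊆ A)
    (hB : S ⊆ B) : K.proj B ∘L K.proj A = K.proj S :=
  ContinuousLinearMap.ext fun v => by
    rw [ContinuousLinearMap.comp_apply, h.proj_eq_proj hB (proj_mem _ _), proj_proj_of_subset hA]

theorem splitsAlong_of_proj_comp_proj {S A B : Set X}
    (h : K.proj S = K.proj A ∘L K.proj B) : K.SplitsAlong S A B := by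
  intro x hx y hy
  rw [inner_sub_left, inner_proj, h, ContinuousLinearMap.comp_apply,
    proj_eq_self (generator_mem_closedSpan hy), ← inner_proj,
    proj_eq_self (generator_mem_closedSpan hx), sub_self]

/-- Conditional orthogonality given `S` persists when `S` is enlarged. -/
theorem SplitsAlong.mono {S S' A B : Set X} (h : K.SplitsAlong S A B) (hS : S ⊆ S') (hA : S ⊆ A)
    (hAB : S' ⊆ A ∪ B) : K.SplitsAlong S' A B := by
  intro x hx y hy
  have hw : K.generator x - K.proj (S' ∩ A) (K.generator x) ∈ K.closedSpan A :=
    Submodule.sub_mem _ (generator_mem_closedSpan hx)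
      (closedSpan_mono Set.inter_subset_right (proj_mem _ _))
  have horth : ∀ u ∈ S' ∩ A,
      ⟪K.generator x - K.proj (S' ∩ A) (K.generator x), K.generator u⟫_ℝ = 0 :=
    fun u hu => inner_sub_proj _ (generator_mem_closedSpan hu)
  have hB : ∀ u ∈ B, ⟪K.generator x - K.proj (S' ∩ A) (K.generator x), K.generator u⟫_ℝ = 0 :=
    fun u hu => h.inner_eq_zero hw (fun s hs => horth s ⟨hS hs, hA hs⟩) hu
  have : K.proj S' (K.generator x) = K.proj (S' ∩ A) (K.generator x) := by
    refine proj_eq_of (closedSpan_mono Set.inter_subset_left (proj_mem _ _)) fun u hu => ?_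
    rcases hAB hu with h1 | h1
    exacts [horth u ⟨hu, h1⟩, hB u h1]
  rw [this]
  exact hB y hy

open Classical in
/-- Two kernels which agree on `A ∩ B` have a common extension from `A` and `B` which makes
`A` and `B` conditionally orthogonal given `A ∩ B`. -/
theorem exists_glue (K₁ K₂ : ReproducingKernel X) (A B : Set X)
    (h : ∀ s ∈ A ∩ B, ∀ t ∈ A ∩ B, K₁ s t = K₂ s t) :
    ∃ K : ReproducingKernel X, (∀ x ∈ A, ∀ y ∈ A, K x y = K₁ x y) ∧
      (∀ x ∈ B, ∀ y ∈ B, K x y = K₂ x y) ∧ K.SplitsAlong (A ∩ B) A B := by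
  set S := A ∩ B with hSdef
  set M := K₁.restrict S with hM
  obtain ⟨J₁, hJ₁, hg₁⟩ := exists_isometry (K := M) (fun s : S => K₁.generator s)
    (fun s t => K₁.inner_generator s t)
  obtain ⟨J₂, hJ₂, hg₂⟩ := exists_isometry (K := M) (fun s : S => K₂.generator s)
    (fun s t => (K₂.inner_generator s t).trans (h s s.2 t t.2).symm)
  have hadj : ∀ {L : ReproducingKernel X} (J : M.H →L[ℝ] L.H),
      (∀ v w, ⟪J v, J w⟫_ℝ = ⟪v, w⟫_ℝ) → ∀ v, J.adjoint (J v) = v := by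
    intro L J hJ v
    refine ext_inner_left ℝ fun w => ?_
    rw [ContinuousLinearMap.adjoint_inner_right, hJ]
  let c : X → M.H := fun x =>
    if x ∈ A then J₁.adjoint (K₁.generator x) else J₂.adjoint (K₂.generator x)
  let d : X → K₁.H := fun x =>
    if x ∈ A then K₁.generator x - J₁ (J₁.adjoint (K₁.generator x)) else 0
  let e : X → K₂.H := fun x =>
    if x ∈ B then K₂.generator x - J₂ (J₂.adjoint (K₂.generator x)) else 0
  have hS₁ : ∀ s (hs : s ∈ S), J₁.adjoint (K₁.generator s) = M.generator ⟨s, hs⟩ := fun s hs => by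
    rw [← hadj J₁ hJ₁ (M.generator ⟨s, hs⟩), hg₁]
  have hS₂ : ∀ s (hs : s ∈ S), J₂.adjoint (K₂.generator s) = M.generator ⟨s, hs⟩ := fun s hs => by
    rw [← hadj J₂ hJ₂ (M.generator ⟨s, hs⟩), hg₂]
  have hcA : ∀ x ∈ A, c x = J₁.adjoint (K₁.generator x) := fun x hx => if_pos hx
  have hcB : ∀ x ∈ B, c x = J₂.adjoint (K₂.generator x) := fun x hx => by
    by_cases hxA : x ∈ A
    · rw [hcA x hxA, hS₁ x ⟨hxA, hx⟩, hS₂ x ⟨hxA, hx⟩]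
    · exact if_neg hxA
  have hdB : ∀ x ∈ B, d x = 0 := fun x hx => by
    by_cases hxA : x ∈ A
    · simp only [d, if_pos hxA]
      rw [hS₁ x ⟨hxA, hx⟩, hg₁, sub_self]
    · exact if_neg hxA
  have heA : ∀ x ∈ A, e x = 0 := fun x hx => by
    by_cases hxB : x ∈ B
    · simp only [e, if_pos hxB]
      rw [hS₂ x ⟨hx, hxB⟩, hg₂, sub_self]
    · exact if_neg hxB
  have hgram : ∀ {L : ReproducingKernel X} (J : M.H →L[ℝ] L.H),
      (∀ v w, ⟪J v, J w⟫_ℝ = ⟪v, w⟫_ℝ) → ∀ v w : L.H,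
      ⟪J.adjoint v, J.adjoint w⟫_ℝ + ⟪v - J (J.adjoint v), w - J (J.adjoint w)⟫_ℝ = ⟪v, w⟫_ℝ := by
    intro L J hJ v w
    simp only [inner_sub_left, inner_sub_right, hJ]
    simp only [← ContinuousLinearMap.adjoint_inner_left J,
      ← ContinuousLinearMap.adjoint_inner_right J]
    ring
  let K : ReproducingKernel X :=
    { toFun := fun x y => ⟪c x, c y⟫_ℝ + ⟪d x, d y⟫_ℝ + ⟪e x, e y⟫_ℝ
      isReproducingKernel := ((isReproducingKernel_gram c).add (isReproducingKernel_gram d)).add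
        (isReproducingKernel_gram e) }
  have hKA : ∀ x ∈ A, ∀ y ∈ A, K x y = K₁ x y := by
    intro x hx y hy
    change ⟪c x, c y⟫_ℝ + ⟪d x, d y⟫_ℝ + ⟪e x, e y⟫_ℝ = _
    rw [heA x hx, inner_zero_left, add_zero, hcA x hx, hcA y hy, ← K₁.inner_generator,
      ← hgram J₁ hJ₁ (K₁.generator x)]
    simp only [d, if_pos hx, if_pos hy]
  have hKB : ∀ x ∈ B, ∀ y ∈ B, K x y = K₂ x y := by
    intro x hx y hy
    change ⟪c x, c y⟫_ℝ + ⟪d x, d y⟫_ℝ + ⟪e x, e y⟫_ℝ = _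
    rw [hdB x hx, inner_zero_left, add_zero, hcB x hx, hcB y hy, ← K₂.inner_generator,
      ← hgram J₂ hJ₂ (K₂.generator x)]
    simp only [e, if_pos hx, if_pos hy]
  refine ⟨K, hKA, hKB, splitsAlong_iff.2 fun x hx y hy => ?_⟩
  have hr : K.restrict S = M := restrict_eq_restrict fun s hs t ht => hKA s hs.1 t ht.1
  rw [eqInnerOn_iff_of_restrict_eq hr]
  refine ⟨c x, c y, fun v => ?_, fun v => ?_, ?_⟩
  · rw [← inner_generator_left, hcA x hx, ContinuousLinearMap.adjoint_inner_right, hg₁,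
      inner_generator, hKA x hx v v.2.1, K₁.isReproducingKernel.1]
  · rw [← inner_generator_left, hcB y hy, ContinuousLinearMap.adjoint_inner_right, hg₂,
      inner_generator, hKB y hy v v.2.2, K₂.isReproducingKernel.1]
  · change ⟪c x, c y⟫_ℝ + ⟪d x, d y⟫_ℝ + ⟪e x, e y⟫_ℝ = _
    rw [heA x hx, hdB y hy, inner_zero_left, inner_zero_right, add_zero, add_zero]

open Classical in
/-- A reproducing kernel on a subset extends (by zero) to a reproducing kernel. -/
theorem exists_extension {A : Set X} (L : ReproducingKernel A) :
    ∃ K : ReproducingKernel X, ∀ x y : A, K x y = L x y := by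
  let φ : X → L.H := fun x => if hx : x ∈ A then L.generator ⟨x, hx⟩ else 0
  refine ⟨⟨_, isReproducingKernel_gram φ⟩, fun x y => ?_⟩
  change ⟪φ x, φ y⟫_ℝ = _
  simp [φ, inner_generator]

end ReproducingKernel

open ReproducingKernel

variable {X : Type*}

/-- The union of the first `m` pieces. -/
def initialUnion (V : ℕ → Set X) (m : ℕ) : Set X := ⋃ k ∈ Finset.Icc 1 m, V k

/-- The union of the pieces with indices in `(m, n]`. -/
def finalUnion (V : ℕ → Set X) (m n : ℕ) : Set X := ⋃ k ∈ Finset.Icc (m + 1) n, V k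

theorem mem_initialUnion {V : ℕ → Set X} {m : ℕ} {x : X} :
    x ∈ initialUnion V m ↔ ∃ k, 1 ≤ k ∧ k ≤ m ∧ x ∈ V k := by
  simp [initialUnion, and_assoc]

theorem mem_finalUnion {V : ℕ → Set X} {m n : ℕ} {x : X} :
    x ∈ finalUnion V m n ↔ ∃ k, m < k ∧ k ≤ n ∧ x ∈ V k := by
  simp [finalUnion, and_assoc]

theorem subset_initialUnion {V : ℕ → Set X} {j m : ℕ} (h1 : 1 ≤ j) (hj : j ≤ m) :
    V j ⊆ initialUnion V m := fun _ hx => mem_initialUnion.2 ⟨j, h1, hj, hx⟩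

theorem subset_finalUnion {V : ℕ → Set X} {j m n : ℕ} (h1 : m < j) (hj : j ≤ n) :
    V j ⊆ finalUnion V m n := fun _ hx => mem_finalUnion.2 ⟨j, h1, hj, hx⟩

theorem initialUnion_mono {V : ℕ → Set X} {j m : ℕ} (h : j ≤ m) :
    initialUnion V j ⊆ initialUnion V m := fun _ hx => by
  obtain ⟨k, h1, h2, h3⟩ := mem_initialUnion.1 hx
  exact mem_initialUnion.2 ⟨k, h1, h2.trans h, h3⟩

theorem mem_initialUnion_succ {V : ℕ → Set X} {m : ℕ} {x : X}
    (hx : x ∈ initialUnion V (m + 1)) : x ∈ initialUnion V m ∨ x ∈ V (m + 1) := by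
  obtain ⟨k, h1, h2, h3⟩ := mem_initialUnion.1 hx
  rcases Nat.le_succ_iff.1 h2 with h | rfl
  exacts [Or.inl (mem_initialUnion.2 ⟨k, h1, h, h3⟩), Or.inr h3]

theorem initialUnion_zero (V : ℕ → Set X) : initialUnion V 0 = ∅ := by simp [initialUnion]

namespace IsSerrated

variable {n : ℕ} {V : ℕ → Set X} {Ω : Set (X × X)}

theorem initialUnion_eq_univ (h : IsSerrated n V Ω) : initialUnion V n = Set.univ := h.cover

theorem mem_iff (h : IsSerrated n V Ω) {x y : X} :
    (x, y) ∈ Ω ↔ ∃ k, 1 ≤ k ∧ k ≤ n ∧ x ∈ V k ∧ y ∈ V k := by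
  simp only [h.eq_iUnion, Set.mem_iUnion, Finset.mem_Icc, Set.mem_prod, exists_prop, and_assoc]

theorem prod_subset (h : IsSerrated n V Ω) {j : ℕ} (h1 : 1 ≤ j) (hj : j ≤ n) :
    V j ×ˢ V j ⊆ Ω := fun _ hp => h.mem_iff.2 ⟨j, h1, hj, hp⟩

theorem initialUnion_union_finalUnion (h : IsSerrated n V Ω) (j : ℕ) :
    initialUnion V j ∪ finalUnion V j n = Set.univ := by
  refine Set.eq_univ_of_univ_subset fun x _ => ?_
  have hx : x ∈ initialUnion V n := by rw [h.initialUnion_eq_univ]; trivial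
  obtain ⟨k, h1, h2, h3⟩ := mem_initialUnion.1 hx
  rcases le_or_gt k j with hk | hk
  exacts [Or.inl (mem_initialUnion.2 ⟨k, h1, hk, h3⟩), Or.inr (mem_finalUnion.2 ⟨k, hk, h2, h3⟩)]

theorem initialUnion_inter_finalUnion_subset (h : IsSerrated n V Ω) (j : ℕ) :
    initialUnion V j ∩ finalUnion V j n ⊆ V j ∩ V (j + 1) := by
  rintro x ⟨hA, hB⟩
  obtain ⟨i, hi1, hi2, hi⟩ := mem_initialUnion.1 hA
  obtain ⟨k, hk1, hk2, hk⟩ := mem_finalUnion.1 hB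
  have key : ∀ l, i ≤ l → l ≤ k → x ∈ V l := by
    intro l hl1 hl2
    rcases hl1.eq_or_lt with rfl | h1
    · exact hi
    rcases hl2.eq_or_lt with rfl | h2
    · exact hk
    exact (h.inter_subset i l k hi1 h1 h2 hk2 ⟨hi, hk⟩).2
  exact ⟨key j hi2 hk1.le, key (j + 1) (by omega) hk1⟩

theorem initialUnion_inter_succ (h : IsSerrated n V Ω) {j : ℕ} (h1 : 1 ≤ j) (hj : j < n) :
    initialUnion V j ∩ V (j + 1) = V j ∩ V (j + 1) := by
  refine subset_antisymm (fun x hx => ?_)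
    (Set.inter_subset_inter_left _ (subset_initialUnion h1 le_rfl))
  exact h.initialUnion_inter_finalUnion_subset j
    ⟨hx.1, subset_finalUnion j.lt_succ_self hj hx.2⟩

end IsSerrated

/-- The conditional orthogonality of each piece and the union of the preceding pieces, given the
intersection of consecutive pieces. -/
def IsMarkov (n : ℕ) (V : ℕ → Set X) (K : ReproducingKernel X) : Prop :=
  ∀ j, 1 ≤ j → j < n → K.SplitsAlong (V j ∩ V (j + 1)) (initialUnion V j) (V (j + 1))

variable {n : ℕ} {V : ℕ → Set X} {Ω : Set (X × X)} {KΩ : Ω → ℝ} {K : ReproducingKernel X}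

theorem IsMarkov.splitsAlong (hK : IsMarkov n V K) {j : ℕ} (h1 : 1 ≤ j) (hj : j < n) :
    K.SplitsAlong (V j ∩ V (j + 1)) (initialUnion V j) (finalUnion V j n) := by
  intro x hx y hy
  obtain ⟨k, hk1, hk2, hk⟩ := mem_finalUnion.1 hy
  have key : ∀ l, j + 1 ≤ l → l ≤ n → ∀ y ∈ V l,
      ⟪K.generator x - K.proj (V j ∩ V (j + 1)) (K.generator x), K.generator y⟫_ℝ = 0 := by
    intro l hl
    induction l, hl using Nat.le_induction with
    | base => exact fun _ y hy => hK j h1 hj x hx y hy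
    | succ l hl ih =>
      intro hn y hy
      refine (hK l (by omega) hn).inner_eq_zero ?_ (fun s hs => ih (by omega) s hs.1) hy
      refine Submodule.sub_mem _
        (generator_mem_closedSpan (initialUnion_mono (by omega) hx))
        (closedSpan_mono ?_ (proj_mem _ _))
      exact Set.inter_subset_left.trans (subset_initialUnion h1 (by omega))
  exact key k hk1 hk2 y hk

theorem IsCompletion.apply_eq (hΩ : IsSerrated n V Ω) {L : ReproducingKernel X}
    (hK : IsCompletion KΩ K) (hL : IsCompletion KΩ L) {j : ℕ} (h1 : 1 ≤ j) (hj : j ≤ n)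
    {x y : X} (hx : x ∈ V j) (hy : y ∈ V j) : K x y = L x y := by
  have hp : (x, y) ∈ Ω := hΩ.prod_subset h1 hj ⟨hx, hy⟩
  exact (hK ⟨_, hp⟩).trans (hL ⟨_, hp⟩).symm

theorem IsMarkov.eq_of_isCompletion (hΩ : IsSerrated n V Ω) {L : ReproducingKernel X}
    (hK : IsCompletion KΩ K) (hL : IsCompletion KΩ L) (hKM : IsMarkov n V K)
    (hLM : IsMarkov n V L) : K = L := by
  have key : ∀ m, m ≤ n → ∀ x ∈ initialUnion V m, ∀ y ∈ initialUnion V m, K x y = L x y := by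
    intro m
    induction m with
    | zero => simp [initialUnion_zero]
    | succ m ih =>
      intro hm
      specialize ih (by omega)
      have hV : ∀ x ∈ V (m + 1), ∀ y ∈ V (m + 1), K x y = L x y := fun x hx y hy =>
        hK.apply_eq hΩ hL (by omega) hm hx hy
      have hmix : ∀ x ∈ initialUnion V m, ∀ y ∈ V (m + 1), K x y = L x y := by
        intro x hx y hy
        rcases m.eq_zero_or_pos with rfl | h1
        · simp [initialUnion_zero] at hx
        have hS : ∀ s ∈ V m ∩ V (m + 1), s ∈ initialUnion V m := fun s hs =>
          subset_initialUnion h1 le_rfl hs.1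
        exact (splitsAlong_iff.1 (hKM m h1 hm) x hx y hy).apply_eq
          (splitsAlong_iff.1 (hLM m h1 hm) x hx y hy)
          (fun s hs t ht => ih s (hS s hs) t (hS t ht)) (fun s hs => ih x hx s (hS s hs))
          (fun s hs => hV y hy s hs.2)
      intro x hx y hy
      rcases mem_initialUnion_succ hx with hx | hx <;> rcases mem_initialUnion_succ hy with hy | hy
      · exact ih x hx y hy
      · exact hmix x hx y hy
      · rw [K.isReproducingKernel.1, L.isReproducingKernel.1, hmix y hy x hx]
      · exact hV x hx y hy
  refine ReproducingKernel.ext (funext fun x => funext fun y => key n le_rfl x ?_ y ?_) <;>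
    simp [hΩ.initialUnion_eq_univ]

theorem IsPartiallyReproducing.exists_kernel (hKΩ : IsPartiallyReproducing KΩ) {A : Set X}
    (hA : A ×ˢ A ⊆ Ω) : ∃ L : ReproducingKernel X,
      ∀ (x y : X) (hx : x ∈ A) (hy : y ∈ A), L x y = KΩ ⟨(x, y), hA ⟨hx, hy⟩⟩ := by
  obtain ⟨L, hL⟩ := exists_extension ⟨_, hKΩ A hA⟩
  exact ⟨L, fun x y hx hy => hL ⟨x, hx⟩ ⟨y, hy⟩⟩

/-- A partially reproducing kernel on a serrated domain has a Markov completion. -/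
theorem exists_isMarkov (hΩ : IsSerrated n V Ω) (hKΩ : IsPartiallyReproducing KΩ) :
    ∃ K : ReproducingKernel X, IsCompletion KΩ K ∧ IsMarkov n V K := by
  have key : ∀ m, 1 ≤ m → m ≤ n → ∃ K : ReproducingKernel X, IsMarkov m V K ∧
      ∀ p : Ω, (∃ k, 1 ≤ k ∧ k ≤ m ∧ p.1.1 ∈ V k ∧ p.1.2 ∈ V k) → K p.1.1 p.1.2 = KΩ p := by
    intro m h1
    induction m, h1 using Nat.le_induction with
    | base =>
      intro hn
      obtain ⟨L, hL⟩ := hKΩ.exists_kernel (hΩ.prod_subset le_rfl hn)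
      refine ⟨L, fun j h1 h2 => absurd h2 (by omega), ?_⟩
      rintro p ⟨k, h1, h2, hx, hy⟩
      obtain rfl : k = 1 := by omega
      exact hL _ _ hx hy
    | succ m h1 ih =>
      intro hn
      obtain ⟨K₁, hM, hK₁⟩ := ih (by omega)
      obtain ⟨K₂, hK₂⟩ := hKΩ.exists_kernel (hΩ.prod_subset (j := m + 1) (by omega) hn)
      have hS := hΩ.initialUnion_inter_succ h1 hn
      obtain ⟨K, hKA, hKB, hK⟩ := exists_glue K₁ K₂ (initialUnion V m) (V (m + 1)) (by
        intro s hs t ht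
        rw [hS] at hs ht
        rw [hK₂ s t hs.2 ht.2]
        exact hK₁ ⟨(s, t), _⟩ ⟨m, h1, le_rfl, hs.1, ht.1⟩)
      refine ⟨K, fun j hj1 hj => ?_, ?_⟩
      · rcases (Nat.lt_succ_iff.1 hj).eq_or_lt with rfl | hjm
        · rwa [hS] at hK
        · have hA := initialUnion_mono (V := V) hjm.le
          have hB := subset_initialUnion (V := V) (j := j + 1) (m := m) (by omega) hjm
          have hSA : ∀ s ∈ V j ∩ V (j + 1), s ∈ initialUnion V m := fun s hs => hB hs.2
          refine splitsAlong_iff.2 fun x hx y hy => ?_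
          exact (splitsAlong_iff.1 (hM j hj1 hjm) x hx y hy).congr
            (fun s hs t ht => (hKA s (hSA s hs) t (hSA t ht)).symm)
            (fun s hs => (hKA x (hA hx) s (hSA s hs)).symm)
            (fun s hs => (hKA y (hB hy) s (hSA s hs)).symm)
            (hKA x (hA hx) y (hB hy)).symm
      · rintro p ⟨k, hk1, hk2, hx, hy⟩
        rcases Nat.le_succ_iff.1 hk2 with hk | rfl
        · have hA := subset_initialUnion (V := V) hk1 hk
          rw [hKA _ (hA hx) _ (hA hy)]
          exact hK₁ p ⟨k, hk1, hk, hx, hy⟩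
        · rw [hKB _ hx _ hy]
          exact hK₂ _ _ hx hy
  obtain ⟨K, hM, hK⟩ := key n hΩ.one_le le_rfl
  exact ⟨K, fun p => hK p (hΩ.mem_iff.1 p.2), hM⟩

theorem IsSerrated.separates (hΩ : IsSerrated n V Ω) {j : ℕ} {x y : X}
    (hx : x ∈ initialUnion V j) (hy : y ∈ finalUnion V j n)
    (hxS : x ∉ V j ∩ V (j + 1)) (hyS : y ∉ V j ∩ V (j + 1)) :
    Separates Ω (V j ∩ V (j + 1)) x y := by
  refine ⟨hxS, hyS, fun m z h0 h1 hz => ?_⟩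
  by_contra! hcon
  have hstep : ∀ k ≤ m, z k ∈ initialUnion V j → z k ∉ V j ∩ V (j + 1) →
      z (k + 1) ∈ initialUnion V j := by
    intro k hk hA hS
    obtain ⟨i, hi1, hi2, hi3, hi4⟩ := hΩ.mem_iff.1 (hz k hk)
    rcases le_or_gt i j with hij | hij
    · exact subset_initialUnion hi1 hij hi4
    · exact absurd (hΩ.initialUnion_inter_finalUnion_subset j
        ⟨hA, subset_finalUnion hij hi2 hi3⟩) hS
  have hind : ∀ k ≤ m, z k ∈ initialUnion V j ∧ z k ∉ V j ∩ V (j + 1) := by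
    intro k
    induction k with
    | zero => exact fun _ => by rw [h0]; exact ⟨hx, hxS⟩
    | succ k ih =>
      intro hk
      obtain ⟨h2, h3⟩ := ih (by omega)
      exact ⟨hstep k (by omega) h2 h3, hcon (k + 1) (by omega) hk⟩
  obtain ⟨h2, h3⟩ := hind m le_rfl
  have h4 := hstep m le_rfl h2 h3
  rw [h1] at h4
  exact hyS (hΩ.initialUnion_inter_finalUnion_subset j ⟨h4, hy⟩)

theorem IsCanonicalCompletion.isMarkov (hΩ : IsSerrated n V Ω)
    (hK : IsCanonicalCompletion KΩ K) : IsMarkov n V K := by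
  refine fun j _ hj => splitsAlong_iff.2 fun x hx y hy => ?_
  by_cases hxS : x ∈ V j ∩ V (j + 1)
  · exact eqInnerOn_of_mem_left hxS
  by_cases hyS : y ∈ V j ∩ V (j + 1)
  · exact eqInnerOn_of_mem_right hyS
  exact hK.2 _ x y
    (hΩ.separates hx (subset_finalUnion j.lt_succ_self hj hy) hxS hyS)

theorem IsSerrated.separates_symm (hΩ : IsSerrated n V Ω) {S : Set X} {x y : X}
    (h : Separates Ω S x y) : Separates Ω S y x := by
  obtain ⟨hx, hy, h⟩ := h
  refine ⟨hy, hx, fun m z h0 h1 hz => ?_⟩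
  obtain ⟨k, hk1, hk2, hk⟩ := h m (fun k => z (m + 1 - k)) h1 (by simpa using h0) (by
    intro k hk
    obtain ⟨i, hi1, hi2, hi3, hi4⟩ := hΩ.mem_iff.1 (hz (m - k) (by omega))
    refine hΩ.mem_iff.2 ⟨i, hi1, hi2, ?_, ?_⟩
    · rwa [show m + 1 - k = m - k + 1 by omega]
    · rwa [show m + 1 - (k + 1) = m - k by omega])
  exact ⟨m + 1 - k, by omega, by omega, hk⟩

/-- A separator of a point of `V a` and a point of `V b` contains one of the intersections of
consecutive pieces between `a` and `b`. -/
theorem IsSerrated.exists_inter_subset (hΩ : IsSerrated n V Ω) {S : Set X} {x y : X} {a b : ℕ}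
    (ha : 1 ≤ a) (hab : a ≤ b) (hb : b ≤ n) (hx : x ∈ V a) (hy : y ∈ V b)
    (h : Separates Ω S x y) : ∃ j, a ≤ j ∧ j < b ∧ V j ∩ V (j + 1) ⊆ S := by
  by_contra! hcon
  have hex : ∀ j, ∃ s, a ≤ j → j < b → s ∈ V j ∩ V (j + 1) ∧ s ∉ S := by
    intro j
    by_cases hj : a ≤ j ∧ j < b
    · obtain ⟨s, hs⟩ := Set.not_subset.1 (hcon j hj.1 hj.2)
      exact ⟨s, fun _ _ => hs⟩
    · exact ⟨x, fun h1 h2 => absurd ⟨h1, h2⟩ hj⟩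
  choose s hs using hex
  let z : ℕ → X := fun k => if k = 0 then x else if k ≤ b - a then s (a + k - 1) else y
  have hz0 : z 0 = x := rfl
  have hz1 : ∀ k, 1 ≤ k → k ≤ b - a → z k = s (a + k - 1) := fun k h1 h2 => by
    simp only [z]
    rw [if_neg (by omega), if_pos h2]
  have hz2 : z (b - a + 1) = y := by
    simp only [z]
    rw [if_neg (by omega), if_neg (by omega)]
  obtain ⟨k, hk1, hk2, hk⟩ := h.2.2 (b - a) z hz0 hz2 (by
    intro k hk
    refine hΩ.mem_iff.2 ⟨a + k, by omega, by omega, ?_, ?_⟩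
    · rcases k.eq_zero_or_pos with rfl | hk0
      · rwa [hz0]
      · have := (hs (a + k - 1) (by omega) (by omega)).1.2
        rwa [hz1 k hk0 hk, show a + k = a + k - 1 + 1 by omega]
    · rcases hk.eq_or_lt with rfl | hk'
      · rwa [hz2, show a + (b - a) = b by omega]
      · rw [hz1 (k + 1) (by omega) hk']
        exact (hs (a + k) (by omega) (by omega)).1.1)
  rw [hz1 k hk1 hk2] at hk
  exact (hs (a + k - 1) (by omega) (by omega)).2 hk

theorem IsMarkov.eqInnerOn (hΩ : IsSerrated n V Ω) (hK : IsMarkov n V K) {S : Set X} {x y : X}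
    (h : Separates Ω S x y) : K.EqInnerOn S x y := by
  have key : ∀ {x y : X} {a b : ℕ}, 1 ≤ a → a ≤ b → b ≤ n → x ∈ V a → y ∈ V b →
      Separates Ω S x y → K.EqInnerOn S x y := by
    intro x y a b ha hab hb hx hy h
    obtain ⟨j, hj1, hj2, hj⟩ := hΩ.exists_inter_subset ha hab hb hx hy h
    refine splitsAlong_iff.1 ((hK.splitsAlong (j := j) (by omega) (by omega)).mono hj ?_ ?_) x
      (subset_initialUnion ha hj1 hx) y (subset_finalUnion hj2 hb hy)
    · exact Set.inter_subset_left.trans (subset_initialUnion (by omega) le_rfl)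
    · rw [hΩ.initialUnion_union_finalUnion]
      exact Set.subset_univ _
  have hmem : ∀ z : X, z ∈ initialUnion V n := by simp [hΩ.initialUnion_eq_univ]
  obtain ⟨a, ha1, ha2, ha⟩ := mem_initialUnion.1 (hmem x)
  obtain ⟨b, hb1, hb2, hb⟩ := mem_initialUnion.1 (hmem y)
  rcases le_total a b with hab | hab
  · exact key ha1 hab hb2 ha hb h
  · exact (key hb1 hab ha2 hb ha (hΩ.separates_symm h)).symm

theorem isCanonicalCompletion_iff_isMarkov (hΩ : IsSerrated n V Ω) (hK : IsCompletion KΩ K) :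
    IsCanonicalCompletion KΩ K ↔ IsMarkov n V K :=
  ⟨fun h => h.isMarkov hΩ, fun h => ⟨hK, fun _ _ _ hS => h.eqInnerOn hΩ hS⟩⟩

theorem isMarkov_iff_proj_comp_proj :
    IsMarkov n V K ↔ ∀ j, 1 ≤ j → j < n →
      K.proj (V j ∩ V (j + 1)) = K.proj (initialUnion V j) ∘L K.proj (finalUnion V j n) ∧
        K.proj (initialUnion V j) ∘L K.proj (finalUnion V j n) =
          K.proj (finalUnion V j n) ∘L K.proj (initialUnion V j) := by
  constructor
  · intro hK j h1 hj
    have h := hK.splitsAlong h1 hj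
    have hA : V j ∩ V (j + 1) ⊆ initialUnion V j :=
      Set.inter_subset_left.trans (subset_initialUnion h1 le_rfl)
    have hB : V j ∩ V (j + 1) ⊆ finalUnion V j n :=
      Set.inter_subset_right.trans (subset_finalUnion j.lt_succ_self hj)
    rw [h.proj_comp_proj hA hB, h.symm.proj_comp_proj hB hA]
    exact ⟨rfl, rfl⟩
  · intro h j h1 hj x hx y hy
    exact splitsAlong_of_proj_comp_proj (h j h1 hj).1 x hx y
      (subset_finalUnion j.lt_succ_self hj hy)

/-- The part of the `i`-th piece (counted from `0`) shared with its predecessor. -/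
def overlap (V : ℕ → Set X) : ℕ → Set X
  | 0 => ∅
  | i + 1 => V (i + 1) ∩ V (i + 2)

/-- The increment of projections `Π_{V_{i+1}} - Π_{V_i ∩ V_{i+1}}`, for `i = 0` just `Π_{V_1}`. -/
def projIncrement (V : ℕ → Set X) (K : ReproducingKernel X) (i : ℕ) : K.H →L[ℝ] K.H :=
  K.proj (V (i + 1)) - K.proj (overlap V i)

theorem overlap_subset (V : ℕ → Set X) (i : ℕ) : overlap V i ⊆ V (i + 1) := by
  cases i with
  | zero => exact Set.empty_subset _
  | succ i => exact Set.inter_subset_right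

theorem overlap_subset_initialUnion (V : ℕ → Set X) (i : ℕ) : overlap V i ⊆ initialUnion V i := by
  cases i with
  | zero => exact Set.empty_subset _
  | succ i => exact Set.inter_subset_left.trans (subset_initialUnion (by omega) le_rfl)

theorem sum_projIncrement (V : ℕ → Set X) (K : ReproducingKernel X) {m : ℕ} (hm : 1 ≤ m) :
    ∑ i ∈ Finset.range m, projIncrement V K i =
      ∑ j ∈ Finset.Icc 1 m, K.proj (V j) - ∑ j ∈ Finset.Ico 1 m, K.proj (V j ∩ V (j + 1)) := by
  induction m, hm using Nat.le_induction with
  | base => simp [projIncrement, overlap, proj_empty]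
  | succ m hm ih =>
    obtain ⟨l, rfl⟩ : ∃ l, m = l + 1 := ⟨m - 1, by omega⟩
    rw [Finset.sum_range_succ, ih, Finset.sum_Icc_succ_top (b := l + 1) (by omega),
      Finset.sum_Ico_succ_top (b := l + 1) (by omega), projIncrement, overlap]
    abel

theorem inner_projIncrement (i : ℕ) (v w : K.H) :
    ⟪projIncrement V K i v, w⟫_ℝ = ⟪v, projIncrement V K i w⟫_ℝ := by
  simp only [projIncrement, sub_apply, inner_sub_left, inner_sub_right,
    inner_proj]

theorem projIncrement_projIncrement (i : ℕ) (v : K.H) :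
    projIncrement V K i (projIncrement V K i v) = projIncrement V K i v := by
  have h := overlap_subset V i
  simp only [projIncrement, sub_apply, map_sub, proj_proj_of_subset h,
    proj_proj_of_superset h, proj_eq_self (proj_mem _ _)]
  abel

/-- Symmetric idempotents which sum to the identity annihilate one another. -/
theorem apply_apply_eq_zero_of_sum_eq_id {E : Type*} [NormedAddCommGroup E]
    [InnerProductSpace ℝ E] {T : ℕ → E →L[ℝ] E} (hs : ∀ i v w, ⟪T i v, w⟫_ℝ = ⟪v, T i w⟫_ℝ)
    (hi : ∀ i v, T i (T i v) = T i v) {s : Finset ℕ}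
    (hT : ∑ i ∈ s, T i = ContinuousLinearMap.id ℝ E) {i k : ℕ} (his : i ∈ s) (hks : k ∈ s)
    (hik : k ≠ i) (v : E) : T k (T i v) = 0 := by
  set u := T i v with hu
  have hsq : ∀ l, ⟪T l u, u⟫_ℝ = ⟪T l u, T l u⟫_ℝ := fun l => by
    rw [← hs l (T l u) u, hi l u]
  have h1 : ∑ l ∈ s, ⟪T l u, T l u⟫_ℝ = ⟪u, u⟫_ℝ := by
    simp only [← hsq]
    rw [← sum_inner, ← sum_apply, hT, ContinuousLinearMap.id_apply]
  rw [← Finset.add_sum_erase s _ his, show T i u = u from hi i v, add_eq_left] at h1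
  have h2 := (Finset.sum_eq_zero_iff_of_nonneg fun _ _ => real_inner_self_nonneg).1 h1 k
    (Finset.mem_erase.2 ⟨hik, hks⟩)
  exact inner_self_eq_zero.1 h2

theorem isMarkov_of_sum_projIncrement
    (h : ∑ i ∈ Finset.range n, projIncrement V K i = ContinuousLinearMap.id ℝ K.H) :
    IsMarkov n V K := by
  have key : ∀ i k, i < k → k < n → ∀ w ∈ K.closedSpan (V (i + 1)), projIncrement V K k w = 0 := by
    intro i
    induction i with
    | zero =>
      intro k hk hn w hw
      have hw' : projIncrement V K 0 w = w := by
        simp [projIncrement, overlap, proj_empty, proj_eq_self hw]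
      rw [← hw']
      exact apply_apply_eq_zero_of_sum_eq_id inner_projIncrement projIncrement_projIncrement h
        (by simp; omega) (by simpa) (by omega) w
    | succ i ih =>
      intro k hk hn w hw
      have hw' : w = projIncrement V K (i + 1) w + K.proj (overlap V (i + 1)) w := by
        simp [projIncrement, proj_eq_self hw]
      have hQ := ih k (by omega) hn (K.proj (overlap V (i + 1)) w)
        (closedSpan_mono Set.inter_subset_left (proj_mem _ w))
      rw [hw', map_add, hQ, add_zero]
      exact apply_apply_eq_zero_of_sum_eq_id inner_projIncrement projIncrement_projIncrement h
        (by simp; omega) (by simpa) (by omega) w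
  intro j h1 hj
  obtain ⟨j, rfl⟩ : ∃ l, j = l + 1 := ⟨j - 1, by omega⟩
  refine fun x hx y hy => ?_
  obtain ⟨i, hi1, hi2, hi⟩ := mem_initialUnion.1 hx
  obtain ⟨i, rfl⟩ : ∃ l, i = l + 1 := ⟨i - 1, by omega⟩
  have h0 := key i (j + 1) (by omega) hj _ (generator_mem_closedSpan hi)
  have h2 : K.proj (V (j + 1) ∩ V (j + 1 + 1)) (K.generator x) =
      K.proj (V (j + 1 + 1)) (K.generator x) := by
    rw [projIncrement, sub_apply, sub_eq_zero] at h0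
    exact h0.symm
  rw [h2]
  exact inner_sub_proj _ (generator_mem_closedSpan hy)

theorem IsMarkov.sum_projIncrement (hΩ : IsSerrated n V Ω) (hK : IsMarkov n V K) :
    ∑ i ∈ Finset.range n, projIncrement V K i = ContinuousLinearMap.id ℝ K.H := by
  have key : ∀ m, m ≤ n → ∀ w ∈ K.closedSpan (initialUnion V m),
      (∑ i ∈ Finset.range m, projIncrement V K i) w = w := by
    intro m
    induction m with
    | zero =>
      intro _ w hw
      rw [initialUnion_zero] at hw
      rw [← proj_eq_self hw, proj_empty]
      simp
    | succ m ih =>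
      intro hm w hw
      have hsplit : K.SplitsAlong (overlap V m) (initialUnion V m) (V (m + 1)) := by
        cases m with
        | zero => simp [SplitsAlong, initialUnion_zero]
        | succ m => exact hK (m + 1) (by omega) hm
      have ih := ih (by omega)
      refine eqOn_closedSpan (T := ContinuousLinearMap.id ℝ K.H) (fun x hx => ?_) hw
      rw [Finset.sum_range_succ, add_apply, ContinuousLinearMap.id_apply]
      rcases mem_initialUnion_succ hx with hx | hx
      · have hx' := generator_mem_closedSpan (K := K) hx
        rw [ih _ hx', projIncrement, sub_apply,
          hsplit.proj_eq_proj (overlap_subset V m) hx', sub_self, add_zero]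
      · have hx' := generator_mem_closedSpan (K := K) hx
        set q := K.proj (overlap V m) (K.generator x) with hq
        have hT : projIncrement V K m (K.generator x) = K.generator x - q := by
          rw [projIncrement, sub_apply, proj_eq_self hx']
        have h1 := ih q (closedSpan_mono (overlap_subset_initialUnion V m) (proj_mem _ _))
        have horth : ∀ i < m, ∀ U ⊆ V (i + 1), K.proj U (K.generator x - q) = 0 :=
          fun i hi U hU => proj_eq_zero fun u hu => hsplit.symm x hx u
            (subset_initialUnion (by omega) hi (hU hu))
        have h2 : (∑ i ∈ Finset.range m, projIncrement V K i) (K.generator x - q) = 0 := by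
          rw [sum_apply]
          refine Finset.sum_eq_zero fun i hi => ?_
          rw [Finset.mem_range] at hi
          rw [projIncrement, sub_apply, horth i hi _ subset_rfl,
            horth i hi _ (overlap_subset V i), sub_zero]
        rw [map_sub, h1, sub_eq_zero] at h2
        rw [h2, hT, add_sub_cancel]
  refine ContinuousLinearMap.ext fun w => key n le_rfl w ?_
  rw [hΩ.initialUnion_eq_univ, closedSpan_univ]
  trivial

theorem tfae_of_isCompletion {X : Type*} {n : ℕ} {V : ℕ → Set X} {Ω : Set (X × X)} {KΩ : Ω → ℝ}
    (hΩ : IsSerrated n V Ω) {Kstar K : ReproducingKernel X}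
    (hstar : IsCanonicalCompletion KΩ Kstar) (hK : IsCompletion KΩ K) :
    List.TFAE
      [K = Kstar,
        ContinuousLinearMap.id ℝ K.H =
          ∑ j ∈ Finset.Icc 1 n, K.proj (V j) -
            ∑ j ∈ Finset.Ico 1 n, K.proj (V j ∩ V (j + 1)),
        ∀ j, 1 ≤ j → j < n → ∀ A B : Set X,
          A = ⋃ k ∈ Finset.Icc 1 j, V k → B = ⋃ k ∈ Finset.Icc (j + 1) n, V k →
            K.proj (V j ∩ V (j + 1)) = K.proj A ∘L K.proj B ∧
              K.proj A ∘L K.proj B = K.proj B ∘L K.proj A] := by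
  have h1 : K = Kstar ↔ IsMarkov n V K :=
    ⟨fun h => h ▸ hstar.isMarkov hΩ,
      fun h => h.eq_of_isCompletion hΩ hK hstar.1 (hstar.isMarkov hΩ)⟩
  have h2 : IsMarkov n V K ↔ ContinuousLinearMap.id ℝ K.H =
      ∑ j ∈ Finset.Icc 1 n, K.proj (V j) - ∑ j ∈ Finset.Ico 1 n, K.proj (V j ∩ V (j + 1)) := by
    rw [← sum_projIncrement V K hΩ.one_le, eq_comm]
    exact ⟨fun h => h.sum_projIncrement hΩ, isMarkov_of_sum_projIncrement⟩
  tfae_have 1 ↔ 2 := h1.trans h2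
  tfae_have 1 ↔ 3 := by
    rw [h1, isMarkov_iff_proj_comp_proj]
    refine ⟨fun h j hj1 hj2 A B hA hB => ?_, fun h j hj1 hj2 => h j hj1 hj2 _ _ rfl rfl⟩
    rw [hA, hB]
    exact h j hj1 hj2
  tfae_finish

theorem existsUnique_isCanonicalCompletion {X : Type*} {n : ℕ} {V : ℕ → Set X} {Ω : Set (X × X)}
    {KΩ : Ω → ℝ} (hΩ : IsSerrated n V Ω) (hKΩ : IsPartiallyReproducing KΩ) :
    ∃! Kstar : ReproducingKernel X, IsCanonicalCompletion KΩ Kstar := by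
  obtain ⟨K, hK, hM⟩ := exists_isMarkov hΩ hKΩ
  exact ⟨K, (isCanonicalCompletion_iff_isMarkov hΩ hK).2 hM, fun L hL =>
    (hL.isMarkov hΩ).eq_of_isCompletion hΩ hL.1 hK hM⟩

/-- A union of two squares is a `2`-serrated domain. -/
theorem isSerrated_two {X : Type*} {X₁ X₂ : Set X} (h : X₁ ∪ X₂ = Set.univ) :
    IsSerrated 2 (fun k => if k = 1 then X₁ else X₂) (X₁ ×ˢ X₁ ∪ X₂ ×ˢ X₂) where
  one_le := by norm_num
  cover := by
    rw [show Finset.Icc 1 2 = {1, 2} from rfl]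
    simpa using h
  inter_subset := fun i j k _ _ _ _ => by omega
  eq_iUnion := by
    rw [show Finset.Icc 1 2 = {1, 2} from rfl]
    simp

theorem isMarkov_two {X : Type*} {X₁ X₂ : Set X} {K : ReproducingKernel X} :
    IsMarkov 2 (fun k => if k = 1 then X₁ else X₂) K ↔
      ∀ x ∈ X₁, ∀ y ∈ X₂, K.EqInnerOn (X₁ ∩ X₂) x y := by
  rw [← splitsAlong_iff]
  constructor
  · intro h
    simpa [initialUnion] using h 1 le_rfl one_lt_two
  · intro h j h1 hj
    obtain rfl : j = 1 := by omega
    simpa [initialUnion] using h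

end KernelCompletion

end

open KernelCompletion in
theorem mainTheorem12 {X : Type*} :
    (∀ (n : ℕ) (V : ℕ → Set X) (Ω : Set (X × X)) (KΩ : Ω → ℝ),
      IsSerrated n V Ω → IsPartiallyReproducing KΩ →
        (∃! Kstar : ReproducingKernel X, IsCanonicalCompletion KΩ Kstar) ∧
        ∀ Kstar K : ReproducingKernel X, IsCanonicalCompletion KΩ Kstar → IsCompletion KΩ K →
          List.TFAE
            [K = Kstar,
              ContinuousLinearMap.id ℝ K.H =
                ∑ j ∈ Finset.Icc 1 n, K.proj (V j) -
                  ∑ j ∈ Finset.Ico 1 n, K.proj (V j ∩ V (j + 1)),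
              ∀ j, 1 ≤ j → j < n → ∀ A B : Set X,
                A = ⋃ k ∈ Finset.Icc 1 j, V k → B = ⋃ k ∈ Finset.Icc (j + 1) n, V k →
                  K.proj (V j ∩ V (j + 1)) = K.proj A ∘L K.proj B ∧
                    K.proj A ∘L K.proj B = K.proj B ∘L K.proj A]) ∧
    (∀ (X₁ X₂ : Set X) (Ω : Set (X × X)) (KΩ : Ω → ℝ),
      X₁ ∪ X₂ = Set.univ → Ω = X₁ ×ˢ X₁ ∪ X₂ ×ˢ X₂ → IsPartiallyReproducing KΩ →
        ∃ Kstar : ReproducingKernel X,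
          (∀ K : ReproducingKernel X, IsCanonicalCompletion KΩ K ↔ K = Kstar) ∧
          (∀ K : ReproducingKernel X,
            (IsCompletion KΩ K ∧ ∀ x ∈ X₁, ∀ y ∈ X₂, K.EqInnerOn (X₁ ∩ X₂) x y) ↔ K = Kstar) ∧
          ∀ K : ReproducingKernel X, IsCompletion KΩ K →
            List.TFAE
              [K = Kstar,
                ContinuousLinearMap.id ℝ K.H - K.proj X₁ - K.proj X₂ + K.proj (X₁ ∩ X₂) = 0,
                K.proj (X₁ ∩ X₂) = K.proj X₁ ∘L K.proj X₂ ∧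
                  K.proj X₁ ∘L K.proj X₂ = K.proj X₂ ∘L K.proj X₁]) := by

  refine ⟨fun n V Ω KΩ hΩ hKΩ => ⟨existsUnique_isCanonicalCompletion hΩ hKΩ,
    fun Kstar K hstar hK => tfae_of_isCompletion hΩ hstar hK⟩, ?_⟩
  rintro X₁ X₂ Ω KΩ hX rfl hKΩ
  have hΩ := isSerrated_two hX
  obtain ⟨Kstar, hstar, huniq⟩ := existsUnique_isCanonicalCompletion hΩ hKΩ
  refine ⟨Kstar, fun K => ⟨huniq K, fun h => h ▸ hstar⟩, fun K => ?_, fun K hK => ?_⟩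
  · rw [← isMarkov_two]
    constructor
    · rintro ⟨hK, hM⟩
      exact huniq K ((isCanonicalCompletion_iff_isMarkov hΩ hK).2 hM)
    · rintro rfl
      exact ⟨hstar.1, hstar.isMarkov hΩ⟩
  · have h := tfae_of_isCompletion hΩ hstar hK
    have h12 := h.out 0 1
    have h13 := h.out 0 2
    tfae_have 1 ↔ 2 := by
      rw [h12, show Finset.Icc 1 2 = {1, 2} from rfl, show Finset.Ico 1 2 = {1} from rfl,
        ← sub_eq_zero]
      simp only [Finset.sum_pair (show (1 : ℕ) ≠ 2 by norm_num), Finset.sum_singleton, if_pos,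
        one_add_one_eq_two, if_neg (show ¬(2 : ℕ) = 1 by norm_num)]
      rw [← sub_add, ← sub_sub]
    tfae_have 1 ↔ 3 := by
      rw [h13]
      constructor
      · intro h
        exact h 1 le_rfl one_lt_two X₁ X₂ (by simp) (by simp)
      · rintro h j h1 hj A B rfl rfl
        obtain rfl : j = 1 := by omega
        simpa using h
    tfae_finish
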